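/- Let $D<0$ be an integer, let $N$ be a positive integer, and let $f(x,y)=ax^2+bxy+cy^2$ be a primitive positive definite binary quadratic form with integer coefficients, of discriminant $b^2-4ac=D$ and with $\gcd(a,N)=1$. Let $\mathcal O=\mathbb Z+\mathbb Z\frac{D+\sqrt D}{2}$ be the order of discriminant $D$ in the imaginary quadratic field $K=\mathbb Q(\sqrt D)\subset\mathbb C$, where $\sqrt D$ is the root in the upper half plane. A fractional $\mathcal O$-ideal $\mathfrak a$ is called proper if $\{\alpha\in K\mid \alpha\mathfrak a\subseteq\mathfrak a\}=\mathcal O$; the norm of an $\mathcal O$-ideal $\mathfrak a \subseteq \mathcal O$ is $\mathrm N(\mathfrak a)=|\mathcal O/\mathfrak a|$. Let $\mathcal I(\mathcal O,N)$ be the subgroup of the group of proper fractional $\mathcal O$-ideals generated by the proper $\mathcal O$-ideals $\mathfrak a \subseteq \mathcal O$ with $\mathfrak a+N\mathcal O=\mathcal O$, let $\mathcal P_0(\mathcal O,N)$ be the subgroup generated by the principal ideals $\alpha\mathcal O$ with $0\ne\alpha\in\mathcal O$ and $\alpha\equiv k \pmod{N\mathcal O}$ for some $k\in\mathbb Z$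 with $\gcd(k,N)=1$, and put $\mathcal C_0(\mathcal O,N)=\mathcal I(\mathcal O,N)/\mathcal P_0(\mathcal O,N)$. Let $\mathcal C(D,\Gamma_0(N))$ be the set of primitive positive definite forms of discriminant $D$ whose coefficient of $x^2$ is prime to $N$, modulo the equivalence $Q(x,y)\sim Q(px+qy,rx+sy)$ for $\left(\begin{smallmatrix}p&q\\r&s\end{smallmatrix}\right)\in\Gamma_0(N)$, and let $\Phi:\mathcal C(D,\Gamma_0(N))\to\mathcal C_0(\mathcal O,N)$ be the (well-defined) map $[Q]\mapsto[\mathbb Z+\mathbb Z\tau_Q]$, where $\tau_Q$ is the root of $Q(x,1)=0$ in the upper half plane. **Theorem.** A positive integer $m$ is $N$-represented by $f$, that is, $m=f(x_0,y_0)$ for some $x_0,y_0\in\mathbb Z$ with $\gcd(x_0,N)=1$ and $N\mid y_0$, if and only if there exists a proper $\mathcal O$-ideal $\mathfrak a\subseteq\mathcal O$ lying in the class $\Phi([f])$ such that $m=\mathrm N(\mathfrak a)$. -/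

import Mathlib

open scoped nonZeroDivisors MatrixGroups

/-! ### Binary quadratic forms and `Γ₀(N)`-equivalence -/

/-- The integral binary quadratic form `a x² + b x y + c y²`. -/
@[ext]
structure BinForm where
  a : ℤ
  b : ℤ
  c : ℤ

namespace BinForm

/-- The value `f(x, y)`. -/
def eval (f : BinForm) (x y : ℤ) : ℤ := f.a * x ^ 2 + f.b * x * y + f.c * y ^ 2

/-- The discriminant `b² - 4ac`. -/
def disc (f : BinForm) : ℤ := f.b ^ 2 - 4 * f.a * f.c

/-- The coefficients have no common prime factor. -/
def Primitive (f : BinForm) : Prop := ∀ d : ℤ, d ∣ f.a → d ∣ f.b → d ∣ f.c → IsUnit d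

/-- `f(x, y) > 0` for all `(x, y) ≠ (0, 0)`. -/
def PosDef (f : BinForm) : Prop := ∀ x y : ℤ, (x ≠ 0 ∨ y ≠ 0) → 0 < f.eval x y

/-- The form `f · γ`, that is `(x, y) ↦ f(p x + q y, r x + s y)` for `γ = (p q; r s)`. -/
def act (f : BinForm) (γ : SL(2, ℤ)) : BinForm where
  a := f.eval (γ 0 0) (γ 1 0)
  b := 2 * f.a * γ 0 0 * γ 0 1 + f.b * (γ 0 0 * γ 1 1 + γ 0 1 * γ 1 0)
    + 2 * f.c * γ 1 0 * γ 1 1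
  c := f.eval (γ 0 1) (γ 1 1)

theorem eval_act (f : BinForm) (γ : SL(2, ℤ)) (x y : ℤ) :
    (f.act γ).eval x y = f.eval (γ 0 0 * x + γ 0 1 * y) (γ 1 0 * x + γ 1 1 * y) := by
  simp only [eval, act]; ring

theorem act_one (f : BinForm) : f.act 1 = f := by
  ext <;> simp [act, eval]

theorem act_mul (f : BinForm) (γ δ : SL(2, ℤ)) : f.act (γ * δ) = (f.act γ).act δ := by
  ext <;> simp [act, eval, Matrix.mul_apply, Fin.sum_univ_two] <;> ring

/-- The integer `m` is `N`-represented by `f`: `m = f(x, y)` for some integers `x, y` with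
`gcd(x, N) = 1` and `y ≡ 0 (mod N)`. -/
def NRepresents (f : BinForm) (N : ℕ) (m : ℤ) : Prop :=
  ∃ x y : ℤ, IsCoprime x (N : ℤ) ∧ (N : ℤ) ∣ y ∧ m = f.eval x y

end BinForm

/-- `QF(D)`: the primitive positive definite forms of discriminant `D`. -/
def QF (D : ℤ) : Set BinForm := {f | f.Primitive ∧ f.PosDef ∧ f.disc = D}

/-- The forms in `QF(D)` whose leading coefficient is prime to `N`. -/
def QFN (D : ℤ) (N : ℕ) : Type := {f : BinForm // f ∈ QF D ∧ IsCoprime f.a (N : ℤ)}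

/-- `Γ₀(N)`-equivalence on the forms in `QF(D)` with leading coefficient prime to `N`. -/
def gammaSetoid (D : ℤ) (N : ℕ) : Setoid (QFN D N) where
  r f g := ∃ γ ∈ CongruenceSubgroup.Gamma0 N, g.1 = f.1.act γ
  iseqv :=
    { refl := fun f => ⟨1, one_mem _, (BinForm.act_one _).symm⟩
      symm := by
        rintro f g ⟨γ, hγ, h⟩
        exact ⟨γ⁻¹, inv_mem hγ, by rw [h, ← BinForm.act_mul, mul_inv_cancel, BinForm.act_one]⟩
      trans := by
        rintro f g k ⟨γ, hγ, h⟩ ⟨δ, hδ, h'⟩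
        exact ⟨γ * δ, mul_mem hγ hδ, by rw [h', h, BinForm.act_mul]⟩ }

/-- The set `𝒞(D, Γ₀(N))` of `Γ₀(N)`-classes of forms. -/
def FormClass (D : ℤ) (N : ℕ) : Type := Quotient (gammaSetoid D N)

/-- The class `[f]` in `𝒞(D, Γ₀(N))`. -/
def formClass {D : ℤ} {N : ℕ} (f : BinForm) (hf : f ∈ QF D) (hfN : IsCoprime f.a (N : ℤ)) :
    FormClass D N :=
  Quotient.mk (gammaSetoid D N) ⟨f, hf, hfN⟩

theorem QF.a_pos {D : ℤ} {f : BinForm} (hf : f ∈ QF D) : 0 < f.a := by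
  simpa [BinForm.eval] using hf.2.1 1 0 (by simp)

theorem QF.disc_neg {D : ℤ} {f : BinForm} (hf : f ∈ QF D) : D < 0 := by
  have ha := QF.a_pos hf
  have h := hf.2.1 (-f.b) (2 * f.a) (Or.inr (by omega))
  have h2 : f.eval (-f.b) (2 * f.a) = -(f.a * D) := by
    rw [← hf.2.2]; simp only [BinForm.eval, BinForm.disc]; ring
  rw [h2] at h
  by_contra hD
  have := mul_nonneg ha.le (not_lt.mp hD)
  omega

noncomputable section

/-! ### The order of discriminant `D` in the imaginary quadratic field `ℚ(√D)` -/

/-- For `D < 0`, the square root of `D` in the upper half plane. -/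
def sqrtC (D : ℤ) : ℂ := (Real.sqrt (-(D : ℝ)) : ℂ) * Complex.I

/-- The field `K = ℚ(√D)`, as a subfield of `ℂ`. -/
abbrev QuadField (D : ℤ) : IntermediateField ℚ ℂ := IntermediateField.adjoin ℚ {sqrtC D}

/-- `√D` as an element of `K`. -/
def sqrtK (D : ℤ) : QuadField D := IntermediateField.AdjoinSimple.gen ℚ (sqrtC D)

/-- The order `𝒪 = ℤ[(D + √D)/2] = ℤ + ℤ (D + √D)/2` of discriminant `D` in `K`. -/
def quadOrder (D : ℤ) : Subalgebra ℤ (QuadField D) :=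
  Algebra.adjoin ℤ {((D : QuadField D) + sqrtK D) / 2}

/-- The fractional `𝒪`-ideals in `K` (including the zero ideal, as in Mathlib). -/
abbrev FracIdeal (D : ℤ) : Type := FractionalIdeal (quadOrder D)⁰ (QuadField D)

/-- A fractional `𝒪`-ideal `J` is proper if `{α ∈ K | α J ⊆ J} = 𝒪`. -/
def IsProper {D : ℤ} (J : FracIdeal D) : Prop :=
  {α : QuadField D | ∀ x ∈ J, α * x ∈ J} = (quadOrder D : Set (QuadField D))

/-- The group `ℐ(𝒪, N)`, generated by the proper `𝒪`-ideals `𝔞` that are prime to `N`, that is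
with `𝔞 + N𝒪 = 𝒪`. (For orders in quadratic fields the proper fractional ideals are exactly the
invertible ones, so that the group of all proper fractional ideals is the unit group
`(FracIdeal D)ˣ`.) -/
def idealGroup (D : ℤ) (N : ℕ) : Subgroup (FracIdeal D)ˣ :=
  Subgroup.closure {u | ∃ 𝔞 : Ideal (quadOrder D), IsProper (𝔞 : FracIdeal D) ∧
    𝔞 ⊔ Ideal.span {(N : quadOrder D)} = ⊤ ∧ (u : FracIdeal D) = (𝔞 : FracIdeal D)}

/-- The group `𝒫₀(𝒪, N)`, generated by the principal ideals `α𝒪` with `α ∈ 𝒪` and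
`α ≡ k (mod N𝒪)` for some integer `k` prime to `N`. -/
def principalGroup (D : ℤ) (N : ℕ) : Subgroup (FracIdeal D)ˣ :=
  Subgroup.closure {u | ∃ (α : quadOrder D) (k : ℤ), IsCoprime k (N : ℤ) ∧
    α - (k : quadOrder D) ∈ Ideal.span {(N : quadOrder D)} ∧
    (u : FracIdeal D) = ((Ideal.span {α} : Ideal (quadOrder D)) : FracIdeal D)}

/-- The group `𝒞₀(𝒪, N) = ℐ(𝒪, N) / 𝒫₀(𝒪, N)`. -/
abbrev IdealClass (D : ℤ) (N : ℕ) : Type :=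
  idealGroup D N ⧸ (principalGroup D N).subgroupOf (idealGroup D N)

/-- The `𝒪`-ideal `𝔞` lies in the class `C ∈ 𝒞₀(𝒪, N)`. -/
def InClass {D : ℤ} {N : ℕ} (𝔞 : Ideal (quadOrder D)) (C : IdealClass D N) : Prop :=
  ∃ u : idealGroup D N, ((u : (FracIdeal D)ˣ) : FracIdeal D) = (𝔞 : FracIdeal D) ∧
    (QuotientGroup.mk u : IdealClass D N) = C

/-- The root `τ_f = (-b + √D)/(2a)` of `f(x, 1)` in the upper half plane. -/
def tau (D : ℤ) (f : BinForm) : QuadField D := (-(f.b : QuadField D) + sqrtK D) / (2 * f.a)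

/-! ### The lattice `ℤ + ℤ τ_f` is an element of `ℐ(𝒪, N)` -/

theorem sqrtK_sq {D : ℤ} (hD : D < 0) : (sqrtK D) ^ 2 = (D : QuadField D) := by
  apply Subtype.ext
  have h : ((sqrtK D : QuadField D) : ℂ) = sqrtC D := by simp [sqrtK]
  have hr : (Real.sqrt (-(D : ℝ))) ^ 2 = -(D : ℝ) :=
    Real.sq_sqrt (by
                     have : (D : ℝ) < 0 := by exact_mod_cast hD
                     linarith)
  have hr' : ((Real.sqrt (-(D : ℝ)) : ℂ)) ^ 2 = -(D : ℂ) := by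
    have := congrArg (fun x : ℝ => (x : ℂ)) hr
    push_cast at this
    exact this
  push_cast
  rw [h, sqrtC, mul_pow, hr', Complex.I_sq]
  ring

theorem two_mul_a_tau {D : ℤ} {f : BinForm} (hf : f ∈ QF D) :
    2 * ((f.a : QuadField D) * tau D f) = -(f.b : QuadField D) + sqrtK D := by
  have ha : (f.a : QuadField D) ≠ 0 := by exact_mod_cast (QF.a_pos hf).ne'
  rw [tau]; field_simp

theorem disc_cast {D : ℤ} {f : BinForm} (hf : f ∈ QF D) :
    (D : QuadField D) = (f.b : QuadField D) ^ 2 - 4 * f.a * f.c := by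
  rw [← hf.2.2, BinForm.disc]; push_cast; ring

theorem tau_root {D : ℤ} {f : BinForm} (hf : f ∈ QF D) :
    (f.a : QuadField D) * tau D f ^ 2 + f.b * tau D f + f.c = 0 := by
  have ha : (f.a : QuadField D) ≠ 0 := by exact_mod_cast (QF.a_pos hf).ne'
  have h1 := two_mul_a_tau hf
  have h2 := sqrtK_sq (QF.disc_neg hf)
  rw [disc_cast hf] at h2
  have h3 : sqrtK D = 2 * ((f.a : QuadField D) * tau D f) + f.b := by rw [h1]; ring
  rw [h3] at h2
  have h4 : (4 * (f.a : QuadField D)) * ((f.a : QuadField D) * tau D f ^ 2 + f.b * tau D f + f.c) = 0 := by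
    linear_combination h2
  exact (mul_eq_zero.mp h4).resolve_left (mul_ne_zero (by norm_num) ha)

theorem tau_im_pos {D : ℤ} {f : BinForm} (hf : f ∈ QF D) :
    0 < (((tau D f : QuadField D) : ℂ)).im := by
  have h := congrArg (fun z : QuadField D => ((z : ℂ)).im) (two_mul_a_tau hf)
  have hs : ((sqrtK D : QuadField D) : ℂ) = sqrtC D := by simp [sqrtK]
  have hD : (0 : ℝ) < -(D : ℝ) := by
    have : (D : ℝ) < 0 := by exact_mod_cast QF.disc_neg hf
    linarith
  have ha : (0 : ℝ) < (f.a : ℝ) := by exact_mod_cast QF.a_pos hf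
  have h2 : (((2 : QuadField D)) : ℂ) = 2 := rfl
  push_cast at h
  rw [hs, sqrtC, h2] at h
  have h' : 2 * ((f.a : ℝ) * ((tau D f : QuadField D) : ℂ).im) = Real.sqrt (-(D : ℝ)) := by
    simpa using h
  have hpos := Real.sqrt_pos.mpr hD
  rw [← h'] at hpos
  by_contra hc
  nlinarith

/-- `𝒪 = ℤ + ℤ a τ_f`. -/
theorem mem_quadOrder {D : ℤ} {f : BinForm} (hf : f ∈ QF D) {z : QuadField D} :
    z ∈ quadOrder D ↔ ∃ u v : ℤ, z = u + v * (f.a * tau D f) := by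
  obtain ⟨e, he⟩ : ∃ e : ℤ, D + f.b = 2 * e := by
    have h : Even (f.b * (f.b + 1)) := Int.even_mul_succ_self f.b
    obtain ⟨k, hk⟩ := h
    refine ⟨k - 2 * f.a * f.c, ?_⟩
    rw [← hf.2.2, BinForm.disc]; linear_combination hk
  have he' : (D : QuadField D) + f.b = 2 * e := by exact_mod_cast he
  have hω : ((D : QuadField D) + sqrtK D) / 2 = e + f.a * tau D f := by
    have := two_mul_a_tau hf
    have h2 : (2 : QuadField D) ≠ 0 := two_ne_zero
    field_simp
    linear_combination he' - this
  have hmul := tau_root hf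
  constructor
  · intro hz
    induction hz using Algebra.adjoin_induction with
    | mem x hx =>
      rw [Set.mem_singleton_iff] at hx
      exact ⟨e, 1, by rw [hx, hω]; push_cast; ring⟩
    | algebraMap r => exact ⟨r, 0, by simp⟩
    | add x y _ _ hx hy =>
      obtain ⟨u, v, rfl⟩ := hx
      obtain ⟨u', v', rfl⟩ := hy
      exact ⟨u + u', v + v', by push_cast; ring⟩
    | mul x y _ _ hx hy =>
      obtain ⟨u, v, rfl⟩ := hx
      obtain ⟨u', v', rfl⟩ := hy
      refine ⟨u * u' - v * v' * (f.a * f.c), u * v' + v * u' - v * v' * f.b, ?_⟩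
      push_cast
      linear_combination (v * v' * f.a : QuadField D) * hmul
  · rintro ⟨u, v, rfl⟩
    have h1 : (f.a : QuadField D) * tau D f ∈ quadOrder D := by
      have h : ((D : QuadField D) + sqrtK D) / 2 ∈ quadOrder D :=
        Algebra.subset_adjoin rfl
      have h' : (f.a : QuadField D) * tau D f = ((D : QuadField D) + sqrtK D) / 2 - e := by
        rw [hω]; ring
      rw [h']
      exact sub_mem h (intCast_mem _ e)
    exact add_mem (intCast_mem _ u) (mul_mem (intCast_mem _ v) h1)

/-- The fractional `𝒪`-ideal `ℤ + ℤ τ_f`. -/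
def latticeIdeal {D : ℤ} {f : BinForm} (hf : f ∈ QF D) : FracIdeal D :=
  ⟨{ carrier := {z | ∃ u v : ℤ, z = u + v * tau D f}
     add_mem' := by
      rintro _ _ ⟨u, v, rfl⟩ ⟨u', v', rfl⟩
      exact ⟨u + u', v + v', by push_cast; ring⟩
     zero_mem' := ⟨0, 0, by simp⟩
     smul_mem' := by
      rintro ⟨r, hr⟩ _ ⟨u, v, rfl⟩
      obtain ⟨p, q, rfl⟩ := (mem_quadOrder hf).mp hr
      refine ⟨p * u - q * v * f.c, p * v + q * u * f.a - q * v * f.b, ?_⟩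
      rw [Subalgebra.smul_def, smul_eq_mul]
      push_cast
      linear_combination (q * v : QuadField D) * tau_root hf },
   by
    have ha : (f.a : quadOrder D) ≠ 0 := by exact_mod_cast (QF.a_pos hf).ne'
    refine ⟨(f.a : quadOrder D), mem_nonZeroDivisors_of_ne_zero ha, ?_⟩
    rintro _ ⟨u, v, rfl⟩
    refine ⟨⟨(f.a : QuadField D) * (u + v * tau D f), (mem_quadOrder hf).mpr
      ⟨f.a * u, v, by push_cast; ring⟩⟩, ?_⟩
    rw [Subalgebra.smul_def, smul_eq_mul]
    simp⟩

theorem mem_latticeIdeal {D : ℤ} {f : BinForm} (hf : f ∈ QF D) {z : QuadField D} :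
    z ∈ latticeIdeal hf ↔ ∃ u v : ℤ, z = u + v * tau D f := Iff.rfl

theorem mem_coe_span {D : ℤ} (α : quadOrder D) {z : QuadField D} :
    z ∈ ((Ideal.span {α} : Ideal (quadOrder D)) : FracIdeal D) ↔
      ∃ r ∈ quadOrder D, z = α * r := by
  rw [FractionalIdeal.mem_coeIdeal]
  constructor
  · rintro ⟨x, hx, rfl⟩
    obtain ⟨r, rfl⟩ := Ideal.mem_span_singleton'.mp hx
    exact ⟨r, r.2, by rw [mul_comm]; rfl⟩
  · rintro ⟨r, hr, rfl⟩
    exact ⟨α * ⟨r, hr⟩, Ideal.mul_mem_right _ _ (Ideal.mem_span_singleton_self α), rfl⟩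

theorem mem_span_mul {D : ℤ} (α : quadOrder D) (J : FracIdeal D) {z : QuadField D} :
    z ∈ ((Ideal.span {α} : Ideal (quadOrder D)) : FracIdeal D) * J ↔ ∃ x ∈ J, z = α * x := by
  constructor
  · intro hz
    refine FractionalIdeal.mul_induction_on hz ?_ ?_
    · intro i hi j hj
      obtain ⟨r, hr, rfl⟩ := (mem_coe_span α).mp hi
      exact ⟨r * j, J.1.smul_mem ⟨r, hr⟩ hj, by ring⟩
    · intro x y hx hy
      obtain ⟨x, hx, rfl⟩ := hx
      obtain ⟨y, hy, rfl⟩ := hy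
      exact ⟨x + y, J.1.add_mem hx hy, by ring⟩
  · rintro ⟨x, hx, rfl⟩
    exact FractionalIdeal.mul_mem_mul ((mem_coe_span α).mpr ⟨1, one_mem _, by simp⟩) hx

/-- The form `a x² - b x y + c y²`. -/
def BinForm.opp (f : BinForm) : BinForm := ⟨f.a, -f.b, f.c⟩

theorem BinForm.opp_mem {D : ℤ} {f : BinForm} (hf : f ∈ QF D) : f.opp ∈ QF D := by
  refine ⟨fun d h1 h2 h3 => hf.1 d h1 ((dvd_neg).mp h2) h3, fun x y h => ?_, ?_⟩
  · have := hf.2.1 x (-y) (by simpa using h)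
    simp only [BinForm.eval, BinForm.opp] at this ⊢
    linarith
  · rw [← hf.2.2]; simp [BinForm.disc, BinForm.opp]

/-- `a (ℤ + ℤ τ_f)(ℤ + ℤ τ_g) = 𝒪` for `g = a x² - b x y + c y²`. -/
theorem latticeIdeal_mul {D : ℤ} {f : BinForm} (hf : f ∈ QF D) :
    ((Ideal.span {(f.a : quadOrder D)} : Ideal (quadOrder D)) : FracIdeal D) *
      (latticeIdeal hf * latticeIdeal (BinForm.opp_mem hf)) = 1 := by
  have ha : (f.a : QuadField D) ≠ 0 := by exact_mod_cast (QF.a_pos hf).ne'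
  have hg : (f.a : QuadField D) * tau D f.opp = f.a * tau D f + f.b := by
    have h1 := two_mul_a_tau hf
    have h2 := two_mul_a_tau (BinForm.opp_mem hf)
    have h2' : 2 * ((f.a : QuadField D) * tau D f.opp) = f.b + sqrtK D := by
      simpa [BinForm.opp] using h2
    have : (2 : QuadField D) * (f.a * tau D f.opp - (f.a * tau D f + f.b)) = 0 := by
      linear_combination h2' - h1
    exact sub_eq_zero.mp ((mul_eq_zero.mp this).resolve_left two_ne_zero)
  have hr := tau_root hf
  have hprod : (f.a : QuadField D) * (tau D f * tau D f.opp) = -f.c := by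
    linear_combination tau D f * hg + hr
  apply le_antisymm
  · intro z hz
    obtain ⟨x, hx, rfl⟩ := (mem_span_mul _ _).mp hz
    have key : (f.a : QuadField D) * x ∈ quadOrder D := by
      refine FractionalIdeal.mul_induction_on hx ?_ ?_
      · intro i hi j hj
        obtain ⟨u, v, rfl⟩ := (mem_latticeIdeal hf).mp hi
        obtain ⟨u', v', rfl⟩ := (mem_latticeIdeal _).mp hj
        refine (mem_quadOrder hf).mpr
          ⟨f.a * u * u' + u * v' * f.b - v * v' * f.c, v * u' + u * v', ?_⟩
        push_cast
        linear_combination (u * v' : QuadField D) * hg + (v * v' : QuadField D) * hprod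
      · intro x y hx hy; rw [mul_add]; exact add_mem hx hy
    exact FractionalIdeal.mem_one_iff _ |>.mpr ⟨⟨_, key⟩, by simp⟩
  · rw [FractionalIdeal.one_le]
    obtain ⟨p, q, r, h⟩ : ∃ p q r : ℤ, f.a * p + f.b * q + f.c * r = 1 := by
      have hI : IsUnit (((gcd f.a (gcd f.b f.c)) : ℤ)) :=
        hf.1 _ (gcd_dvd_left _ _) ((gcd_dvd_right _ _).trans (gcd_dvd_left _ _))
          ((gcd_dvd_right _ _).trans (gcd_dvd_right _ _))
      obtain ⟨x, y, hxy⟩ := exists_gcd_eq_mul_add_mul f.a (gcd f.b f.c)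
      obtain ⟨x', y', hxy'⟩ := exists_gcd_eq_mul_add_mul f.b f.c
      obtain ⟨w, hw⟩ := hI.exists_right_inv
      refine ⟨x * w, x' * y * w, y' * y * w, ?_⟩
      rw [hxy] at hw
      linear_combination hw - y * w * hxy'
    have hK : (f.a : QuadField D) * p + f.b * q + f.c * r = 1 := by exact_mod_cast h
    have m1 : (1 : QuadField D) ∈ latticeIdeal hf := ⟨1, 0, by simp⟩
    have mt : tau D f ∈ latticeIdeal hf := ⟨0, 1, by simp⟩
    have m1' : (1 : QuadField D) ∈ latticeIdeal (BinForm.opp_mem hf) := ⟨1, 0, by simp⟩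
    have mt' : tau D f.opp ∈ latticeIdeal (BinForm.opp_mem hf) := ⟨0, 1, by simp⟩
    refine (mem_span_mul _ _).mpr
      ⟨(p * 1) * 1 + (q * 1) * tau D f.opp - (q * tau D f) * 1 - (r * tau D f) * tau D f.opp, ?_, ?_⟩
    · have hz : ∀ (k : ℤ) {x : QuadField D}, x ∈ latticeIdeal hf →
          (k : QuadField D) * x ∈ latticeIdeal hf := fun k x hx => by
        have := (latticeIdeal hf).1.smul_mem (k : quadOrder D) hx
        simpa [Subalgebra.smul_def] using this
      refine Submodule.sub_mem _ (Submodule.sub_mem _ (Submodule.add_mem _ ?_ ?_) ?_) ?_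
      all_goals
        first
        | exact FractionalIdeal.mul_mem_mul (hz _ m1) m1'
        | exact FractionalIdeal.mul_mem_mul (hz _ m1) mt'
        | exact FractionalIdeal.mul_mem_mul (hz _ mt) m1'
        | exact FractionalIdeal.mul_mem_mul (hz _ mt) mt'
    · push_cast
      linear_combination -hK - (q : QuadField D) * hg + (r : QuadField D) * hprod

theorem isUnit_latticeIdeal {D : ℤ} {f : BinForm} (hf : f ∈ QF D) :
    IsUnit (latticeIdeal hf) :=
  isUnit_of_mul_isUnit_left (isUnit_of_mul_isUnit_right
    (by rw [latticeIdeal_mul hf]; exact isUnit_one))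

theorem isUnit_span_a {D : ℤ} {f : BinForm} (hf : f ∈ QF D) :
    IsUnit ((Ideal.span {(f.a : quadOrder D)} : Ideal (quadOrder D)) : FracIdeal D) :=
  isUnit_of_mul_isUnit_left (by rw [latticeIdeal_mul hf]; exact isUnit_one)

/-- An invertible fractional ideal is proper. -/
theorem IsUnit.isProper {D : ℤ} {J : FracIdeal D} (hJ : IsUnit J) : IsProper J := by
  obtain ⟨u, rfl⟩ := hJ
  ext α
  constructor
  · intro h
    have key : ∀ z ∈ (u : FracIdeal D) * ((u⁻¹ : (FracIdeal D)ˣ) : FracIdeal D),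
        α * z ∈ (u : FracIdeal D) * ((u⁻¹ : (FracIdeal D)ˣ) : FracIdeal D) := by
      intro z hz
      refine FractionalIdeal.mul_induction_on hz ?_ ?_
      · intro i hi j hj
        rw [← mul_assoc]
        exact FractionalIdeal.mul_mem_mul (h i hi) hj
      · intro x y hx hy; rw [mul_add]; exact Submodule.add_mem _ hx hy
    rw [Units.mul_inv] at key
    obtain ⟨r, hr⟩ := (FractionalIdeal.mem_one_iff _).mp (key 1 (FractionalIdeal.one_mem_one _))
    rw [mul_one] at hr
    rw [← hr]
    exact r.2
  · intro h x hx
    exact (u : FracIdeal D).1.smul_mem ⟨α, h⟩ hx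

theorem mem_idealGroup_of_integral {D : ℤ} {N : ℕ} (u : (FracIdeal D)ˣ)
    (𝔞 : Ideal (quadOrder D)) (h : (u : FracIdeal D) = (𝔞 : FracIdeal D)) (k : ℤ)
    (hk : IsCoprime k (N : ℤ)) (hk' : (k : quadOrder D) ∈ 𝔞) : u ∈ idealGroup D N := by
  refine Subgroup.subset_closure ⟨𝔞, ?_, ?_, h⟩
  · rw [← h]; exact u.isUnit.isProper
  · rw [Ideal.eq_top_iff_one]
    obtain ⟨x, y, hxy⟩ := hk
    have h1 : (1 : quadOrder D) = x * k + y * N := by exact_mod_cast hxy.symm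
    rw [h1]
    exact Submodule.add_mem_sup (Ideal.mul_mem_left _ _ hk')
      (Ideal.mul_mem_left _ _ (Ideal.mem_span_singleton_self _))

theorem latticeIdeal_mem {D : ℤ} {N : ℕ} {f : BinForm} (hf : f ∈ QF D)
    (hfN : IsCoprime f.a (N : ℤ)) : (isUnit_latticeIdeal hf).unit ∈ idealGroup D N := by
  have h1 : (isUnit_span_a hf).unit ∈ idealGroup D N :=
    mem_idealGroup_of_integral _ _ rfl f.a hfN (Ideal.mem_span_singleton_self _)
  obtain ⟨𝔞, h𝔞⟩ := FractionalIdeal.le_one_iff_exists_coeIdeal.mp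
    (show ((Ideal.span {(f.a : quadOrder D)} : Ideal (quadOrder D)) : FracIdeal D) *
      latticeIdeal hf ≤ 1 by
      intro z hz
      obtain ⟨x, hx, rfl⟩ := (mem_span_mul _ _).mp hz
      obtain ⟨u, v, rfl⟩ := (mem_latticeIdeal hf).mp hx
      exact (FractionalIdeal.mem_one_iff _).mpr ⟨⟨_, (mem_quadOrder hf).mpr
        ⟨f.a * u, v, rfl⟩⟩, by simp; ring⟩)
  have h2 : (isUnit_span_a hf).unit * (isUnit_latticeIdeal hf).unit ∈ idealGroup D N := by
    refine mem_idealGroup_of_integral _ 𝔞 (by rw [h𝔞]; rfl) f.a hfN ?_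
    have h3 : (f.a : QuadField D) ∈ (𝔞 : FracIdeal D) := by
      rw [h𝔞]
      exact (mem_span_mul _ _).mpr ⟨1, ⟨1, 0, by simp⟩, by simp⟩
    obtain ⟨x, hx, hx'⟩ := FractionalIdeal.mem_coeIdeal _ |>.mp h3
    have : x = (f.a : quadOrder D) := Subtype.ext (by simpa using hx')
    rwa [← this]
  exact (Subgroup.mul_mem_cancel_left _ h1).mp h2

/-! ### The map `Φ : 𝒞(D, Γ₀(N)) → 𝒞₀(𝒪, N)`, `[f] ↦ [ℤ + ℤ τ_f]` -/

/-- The lattice `ℤ + ℤ τ_f` as an element of `ℐ(𝒪, N)`. -/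
def latticeUnit {D : ℤ} {N : ℕ} (f : QFN D N) : idealGroup D N :=
  ⟨(isUnit_latticeIdeal f.2.1).unit, latticeIdeal_mem f.2.1 f.2.2⟩

theorem tau_act {D : ℤ} {f g : BinForm} (hf : f ∈ QF D) (hg : g ∈ QF D) (γ : SL(2, ℤ))
    (h : g = f.act γ) :
    ((γ 0 0 : ℤ) - (γ 1 0 : ℤ) * tau D f) * tau D g = ((γ 1 1 : ℤ) : QuadField D) * tau D f - (γ 0 1 : ℤ) := by
  have ha : (f.a : QuadField D) ≠ 0 := by exact_mod_cast (QF.a_pos hf).ne'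
  have hga : (g.a : QuadField D) ≠ 0 := by exact_mod_cast (QF.a_pos hg).ne'
  have hdet : ((γ 0 0 : ℤ) : QuadField D) * (γ 1 1 : ℤ) - (γ 0 1 : ℤ) * (γ 1 0 : ℤ) = 1 := by
    have := γ.det_coe
    rw [Matrix.det_fin_two] at this
    exact_mod_cast this
  have h1 := two_mul_a_tau hf
  have h2 := two_mul_a_tau hg
  have h3 := tau_root hf
  have hb : (g.b : QuadField D) = 2 * f.a * (γ 0 0 : ℤ) * (γ 0 1 : ℤ)
      + f.b * ((γ 0 0 : ℤ) * (γ 1 1 : ℤ) + (γ 0 1 : ℤ) * (γ 1 0 : ℤ))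
      + 2 * f.c * (γ 1 0 : ℤ) * (γ 1 1 : ℤ) := by
    rw [h]; simp only [BinForm.act]; push_cast; ring
  have hA : (g.a : QuadField D) = f.a * (γ 0 0 : ℤ) ^ 2 + f.b * (γ 0 0 : ℤ) * (γ 1 0 : ℤ)
      + f.c * (γ 1 0 : ℤ) ^ 2 := by
    rw [h]; simp only [BinForm.act, BinForm.eval]; push_cast; ring
  generalize ((γ 0 0 : ℤ) : QuadField D) = p at *
  generalize ((γ 0 1 : ℤ) : QuadField D) = q at *
  generalize ((γ 1 0 : ℤ) : QuadField D) = r at *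
  generalize ((γ 1 1 : ℤ) : QuadField D) = s at *
  have key : (2 * (g.a : QuadField D)) * ((p - r * tau D f) * tau D g - (s * tau D f - q)) = 0 := by
    have hs : sqrtK D = 2 * ((f.a : QuadField D) * tau D f) + f.b := by rw [h1]; ring
    have h2' : 2 * ((g.a : QuadField D) * tau D g) = -(g.b : QuadField D)
        + (2 * ((f.a : QuadField D) * tau D f) + f.b) := by rw [h2, hs]
    have e1 : (2 * (g.a : QuadField D)) * ((p - r * tau D f) * tau D g - (s * tau D f - q))
        = (p - r * tau D f) * (2 * ((g.a : QuadField D) * tau D g)) - 2 * g.a * (s * tau D f - q) := by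
      ring
    rw [e1, h2', hb, hA]
    linear_combination (-2 * r) * h3 - (2 * f.a * p * tau D f + f.b * p + f.b * r * tau D f + 2 * f.c * r) * hdet
  exact sub_eq_zero.mp ((mul_eq_zero.mp key).resolve_left (mul_ne_zero two_ne_zero hga))

theorem latticeUnit_eq {D : ℤ} {N : ℕ} (f g : QFN D N) (h : gammaSetoid D N f g) :
    (QuotientGroup.mk (latticeUnit f) : IdealClass D N) = QuotientGroup.mk (latticeUnit g) := by
  obtain ⟨f, hf, hfN⟩ := f
  obtain ⟨g, hg, hgN⟩ := g
  obtain ⟨γ, hγ, h⟩ := h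
  have hdet : ((γ 0 0 : ℤ) : QuadField D) * (γ 1 1 : ℤ) - (γ 0 1 : ℤ) * (γ 1 0 : ℤ) = 1 := by
    have := γ.det_coe
    rw [Matrix.det_fin_two] at this
    exact_mod_cast this
  have ht := tau_act hf hg γ h
  set α : quadOrder D := ⟨f.a * ((γ 0 0 : ℤ) - (γ 1 0 : ℤ) * tau D f), (mem_quadOrder hf).mpr
    ⟨f.a * γ 0 0, -γ 1 0, by push_cast; ring⟩⟩ with hα
  have hmul : ((Ideal.span {α} : Ideal (quadOrder D)) : FracIdeal D) * latticeIdeal hg =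
      ((Ideal.span {(f.a : quadOrder D)} : Ideal (quadOrder D)) : FracIdeal D) *
        latticeIdeal hf := by
    apply FractionalIdeal.ext
    intro z
    rw [mem_span_mul, mem_span_mul]
    constructor
    · rintro ⟨_, ⟨u, v, rfl⟩, rfl⟩
      refine ⟨_, ⟨u * γ 0 0 - v * γ 0 1, v * γ 1 1 - u * γ 1 0, rfl⟩, ?_⟩
      simp only [hα]
      push_cast
      linear_combination (f.a * v : QuadField D) * ht
    · rintro ⟨_, ⟨u, v, rfl⟩, rfl⟩
      refine ⟨_, ⟨u * γ 1 1 + v * γ 0 1, u * γ 1 0 + v * γ 0 0, rfl⟩, ?_⟩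
      simp only [hα]
      push_cast
      linear_combination (-(f.a * (u * (γ 1 0 : ℤ) + v * (γ 0 0 : ℤ))) : QuadField D) * ht
        - (f.a * (u + v * tau D f) : QuadField D) * hdet
  have hB : IsUnit ((Ideal.span {α} : Ideal (quadOrder D)) : FracIdeal D) :=
    isUnit_of_mul_isUnit_left
      (by rw [hmul]; exact (isUnit_span_a hf).mul (isUnit_latticeIdeal hf))
  have hA := isUnit_span_a hf
  have hN : (N : ℤ) ∣ γ 1 0 :=
    (ZMod.intCast_zmod_eq_zero_iff_dvd _ N).mp (CongruenceSubgroup.Gamma0_mem.mp hγ)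
  have hp : IsCoprime (γ 0 0) (N : ℤ) := by
    obtain ⟨k, hk⟩ := hN
    have := γ.det_coe
    rw [Matrix.det_fin_two] at this
    exact ⟨γ 1 1, -(γ 0 1 * k), by linear_combination this + γ 0 1 * hk⟩
  have hAP : hA.unit ∈ principalGroup D N :=
    Subgroup.subset_closure ⟨f.a, f.a, hfN, by simp, rfl⟩
  have hBP : hB.unit ∈ principalGroup D N := by
    refine Subgroup.subset_closure ⟨α, f.a * γ 0 0, hfN.mul_left hp, ?_, rfl⟩
    obtain ⟨k, hk⟩ := hN
    have hk' : ((γ 1 0 : ℤ) : QuadField D) = N * k := by rw [hk]; push_cast; rfl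
    refine Ideal.mem_span_singleton'.mpr ⟨⟨-k * (f.a * tau D f), (mem_quadOrder hf).mpr
      ⟨0, -k, by push_cast; ring⟩⟩, Subtype.ext ?_⟩
    simp only [hα]
    push_cast
    rw [hk']
    ring
  have hU : hB.unit * (isUnit_latticeIdeal hg).unit = hA.unit * (isUnit_latticeIdeal hf).unit :=
    Units.ext hmul
  rw [QuotientGroup.eq, Subgroup.mem_subgroupOf]
  have : ((((latticeUnit ⟨f, hf, hfN⟩ : idealGroup D N))⁻¹ * latticeUnit ⟨g, hg, hgN⟩ :
      idealGroup D N) : (FracIdeal D)ˣ) = hB.unit⁻¹ * hA.unit := by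
    change (isUnit_latticeIdeal hf).unit⁻¹ * (isUnit_latticeIdeal hg).unit = _
    rw [inv_mul_eq_iff_eq_mul, ← mul_assoc, mul_comm _ hB.unit⁻¹, mul_assoc,
      eq_inv_mul_iff_mul_eq, hU, mul_comm]
  rw [this]
  exact mul_mem (inv_mem hBP) hAP

/-- The map `Φ` taking `[f]` to `[ℤ + ℤ τ_f]`. -/
def Phi (D : ℤ) (N : ℕ) : FormClass D N → IdealClass D N :=
  Quotient.lift (fun f : QFN D N => (QuotientGroup.mk (latticeUnit f) : IdealClass D N))
    latticeUnit_eq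

end

/-! Write L = ℤ + ℤτ_f. The point is that the integral ideals in the class of L are the lattices λL
with λ = a(x - yτ̄_f), x prime to N and N ∣ y, and that such a lattice has norm f(x, y).

An ideal in the class of L is λL with λ = α/β, where α ≡ k and β ≡ l (mod N𝒪) for integers k, l
prime to N. Integrality means λ ∈ 𝒪 and λτ_f ∈ 𝒪, and comparing coordinates on 1, τ_f forces λ = a(x
- yτ̄_f) for integers x, y (`exists_eq_conjElement`). In the basis 1, aτ_f of 𝒪 the generators are λ
= (ax + by) + y·aτ_f and λτ_f = -cy + x·aτ_f. The determinant of these coordinates is f(x, y), which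
up to sign is the index of λL in 𝒪 (`natCard_quotient_eq_eval`).

The congruences give lλ ≡ k (mod N𝒪), whence N ∣ y and x is prime to N
(`isCoprime_and_dvd_of_conjElement`). Conversely, N ∣ y gives λ ≡ ax (mod N𝒪), and ax is prime to N
because a and x are, so λ𝒪 is a generator of 𝒫₀. `inClass_Phi_iff` combines the two directions. -/

/-! ### Elements multiplying ℤ + ℤτ_f into 𝒪 -/

/-- `1` and `τ_f` are linearly independent over `ℤ`. -/
theorem int_add_mul_tau_eq_zero {D : ℤ} {f : BinForm} (hf : f ∈ QF D) {u v : ℤ}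
    (h : (u : QuadField D) + v * tau D f = 0) : u = 0 ∧ v = 0 := by
  have hv : v = 0 := by
    have h1 := congrArg (fun z : QuadField D => ((z : ℂ)).im) h
    push_cast at h1
    simp only [Complex.add_im, Complex.mul_im, Complex.intCast_im, Complex.intCast_re,
      zero_mul, add_zero, zero_add, Complex.zero_im, mul_eq_zero] at h1
    exact_mod_cast h1.resolve_right (tau_im_pos hf).ne'
  subst hv
  exact ⟨by simpa using h, rfl⟩

/-- The element `a (x - y τ̄_f) = a x + b y + y (a τ_f)` of `𝒪`. -/
noncomputable def conjElement {D : ℤ} {f : BinForm} (hf : f ∈ QF D) (x y : ℤ) : quadOrder D :=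
  ⟨f.a * x + f.b * y + y * (f.a * tau D f),
    (mem_quadOrder hf).mpr ⟨f.a * x + f.b * y, y, by push_cast; ring⟩⟩

theorem coe_conjElement {D : ℤ} {f : BinForm} (hf : f ∈ QF D) (x y : ℤ) :
    (conjElement hf x y : QuadField D) = f.a * x + f.b * y + y * (f.a * tau D f) := rfl

/-- Equivalent to aτ_f τ̄_f = c; it supplies the second row of the coordinate matrix whose
determinant is f(x, y). -/
theorem conjElement_mul_tau {D : ℤ} {f : BinForm} (hf : f ∈ QF D) (x y : ℤ) :
    (conjElement hf x y : QuadField D) * tau D f = -(f.c * y) + x * (f.a * tau D f) := by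
  rw [coe_conjElement]
  linear_combination (y : QuadField D) * tau_root hf

theorem conjElement_ne_zero {D : ℤ} {f : BinForm} (hf : f ∈ QF D) {x y : ℤ}
    (h : f.eval x y ≠ 0) : (conjElement hf x y : QuadField D) ≠ 0 := by
  intro h0
  rw [coe_conjElement] at h0
  have ha := (QF.a_pos hf).ne'
  obtain ⟨h1, h2⟩ := int_add_mul_tau_eq_zero hf (u := f.a * x + f.b * y) (v := y * f.a)
    (by push_cast; linear_combination h0)
  have hy : y = 0 := (mul_eq_zero.mp h2).resolve_right ha
  subst hy
  have hx : x = 0 := (mul_eq_zero.mp (by simpa using h1)).resolve_left ha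
  subst hx
  exact h (by simp [BinForm.eval])

/-- An element `β ∈ K` with `β (ℤ + ℤ τ_f) ⊆ 𝒪` is of the form `a (x - y τ̄_f)`. -/
theorem exists_eq_conjElement {D : ℤ} {f : BinForm} (hf : f ∈ QF D) {β : QuadField D}
    (h1 : β ∈ quadOrder D) (h2 : β * tau D f ∈ quadOrder D) :
    ∃ x y : ℤ, β = conjElement hf x y := by
  obtain ⟨p, y, rfl⟩ := (mem_quadOrder hf).mp h1
  obtain ⟨q, x, h⟩ := (mem_quadOrder hf).mp h2
  -- With aτ² = -bτ - c, the product (p + y·aτ)τ equals -yc + (p - yb)τ; this is matched with q +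
  -- xaτ. The coefficient of τ determines p.
  obtain ⟨-, hx⟩ := int_add_mul_tau_eq_zero hf (u := q + y * f.c) (v := x * f.a + y * f.b - p)
    (by push_cast; linear_combination (y : QuadField D) * tau_root hf - h)
  have hp : p = f.a * x + f.b * y := by linear_combination -hx
  exact ⟨x, y, by rw [coe_conjElement, hp]; push_cast; ring⟩

/-! ### The norm as a determinant -/

/-- The `ℤ`-basis `1, a τ_f` of `𝒪`. -/
theorem exists_basis_quadOrder {D : ℤ} {f : BinForm} (hf : f ∈ QF D) :
    ∃ e : Module.Basis (Fin 2) ℤ (quadOrder D),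
      (e 0 : QuadField D) = 1 ∧ (e 1 : QuadField D) = f.a * tau D f := by
  let w : quadOrder D := ⟨f.a * tau D f, (mem_quadOrder hf).mpr ⟨0, 1, by simp⟩⟩
  have hli : LinearIndependent ℤ ![1, w] := by
    rw [LinearIndependent.pair_iff]
    intro s t h
    have h' := congrArg (Subtype.val : quadOrder D → QuadField D) h
    simp only [w, zsmul_eq_mul] at h'
    push_cast at h'
    obtain ⟨hs, ht⟩ := int_add_mul_tau_eq_zero hf (u := s) (v := t * f.a)
      (by push_cast; linear_combination h')
    exact ⟨hs, (mul_eq_zero.mp ht).resolve_right (QF.a_pos hf).ne'⟩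
  have hsp : ⊤ ≤ Submodule.span ℤ (Set.range ![1, w]) := by
    rintro ⟨z, hz⟩ -
    obtain ⟨u, v, rfl⟩ := (mem_quadOrder hf).mp hz
    rw [Matrix.range_cons, Matrix.range_cons, Matrix.range_empty, Set.union_empty,
      Set.singleton_union, Submodule.mem_span_pair]
    exact ⟨u, v, Subtype.ext (by simp [w])⟩
  exact ⟨Module.Basis.mk hli hsp, by simp [w], by simp [w]⟩

/-- The ideal `a (x - y τ̄_f) (ℤ + ℤ τ_f)` of `𝒪` has norm `f(x, y)`. -/
theorem natCard_quotient_eq_eval {D : ℤ} {f : BinForm} (hf : f ∈ QF D) {x y : ℤ}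
    (h : f.eval x y ≠ 0) (𝔞 : Ideal (quadOrder D))
    (h𝔞 : (𝔞 : FracIdeal D) =
      ((Ideal.span {conjElement hf x y} : Ideal (quadOrder D)) : FracIdeal D) *
        latticeIdeal hf) :
    Nat.card (quadOrder D ⧸ 𝔞) = (f.eval x y).natAbs := by
  obtain ⟨e, he0, he1⟩ := exists_basis_quadOrder hf
  have hmem : ∀ z : quadOrder D, z ∈ 𝔞 ↔
      ∃ u v : ℤ, (z : QuadField D) = conjElement hf x y * (u + v * tau D f) := by
    intro z
    have h1 : z ∈ 𝔞 ↔ (z : QuadField D) ∈ (𝔞 : FracIdeal D) := by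
      rw [FractionalIdeal.mem_coeIdeal]
      exact ⟨fun hz => ⟨z, hz, rfl⟩, fun ⟨t, ht, htz⟩ => by rwa [← Subtype.ext htz]⟩
    rw [h1, h𝔞, mem_span_mul]
    constructor
    · rintro ⟨_, ⟨u, v, rfl⟩, hz⟩
      exact ⟨u, v, hz⟩
    · rintro ⟨u, v, hz⟩
      exact ⟨_, ⟨u, v, rfl⟩, hz⟩
  -- `p` and `q` are λ and λτ_f in coordinates on 1, aτ_f; they will form a ℤ-basis of 𝔞.
  let p : quadOrder D := (f.a * x + f.b * y) • e 0 + y • e 1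
  let q : quadOrder D := (-(f.c * y)) • e 0 + x • e 1
  have hp : (p : QuadField D) = conjElement hf x y := by
    simp only [p, coe_conjElement, zsmul_eq_mul]
    push_cast
    rw [he0, he1]
    ring
  have hq : (q : QuadField D) = conjElement hf x y * tau D f := by
    rw [conjElement_mul_tau]
    simp only [q, zsmul_eq_mul]
    push_cast
    rw [he0, he1]
    ring
  have hpm : p ∈ 𝔞 := (hmem p).mpr ⟨1, 0, by rw [hp]; simp⟩
  have hqm : q ∈ 𝔞 := (hmem q).mpr ⟨0, 1, by rw [hq]; simp⟩
  -- In this proof `N` is 𝔞 viewed as a ℤ-module, not the level.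
  let N : Submodule ℤ (quadOrder D) := 𝔞.restrictScalars ℤ
  let P : N := ⟨p, hpm⟩
  let Q : N := ⟨q, hqm⟩
  have hli : LinearIndependent ℤ ![P, Q] := by
    rw [LinearIndependent.pair_iff]
    intro s t hst
    have h' := congrArg (fun z : N => ((z : quadOrder D) : QuadField D)) hst
    simp only [P, Q, zsmul_eq_mul, Submodule.coe_add, Submodule.coe_smul,
      Submodule.coe_zero] at h'
    push_cast at h'
    rw [hp, hq] at h'
    exact int_add_mul_tau_eq_zero hf ((mul_eq_zero.mp
      (show (conjElement hf x y : QuadField D) * (s + t * tau D f) = 0 by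
        linear_combination h')).resolve_left (conjElement_ne_zero hf h))
  have hsp : ⊤ ≤ Submodule.span ℤ (Set.range ![P, Q]) := by
    rintro ⟨z, hz⟩ -
    obtain ⟨u, v, huv⟩ := (hmem z).mp hz
    rw [Matrix.range_cons, Matrix.range_cons, Matrix.range_empty, Set.union_empty,
      Set.singleton_union, Submodule.mem_span_pair]
    refine ⟨u, v, Subtype.ext (Subtype.ext ?_)⟩
    simp only [P, Q, zsmul_eq_mul, Submodule.coe_add, Submodule.coe_smul]
    push_cast
    rw [huv, hp, hq]
    ring
  have : Module.Free ℤ (quadOrder D) := Module.Free.of_basis e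
  have : Module.Finite ℤ (quadOrder D) := Module.Finite.of_basis e
  -- The index of a full-rank sublattice is the absolute value of the determinant of its basis.
  have key := Submodule.natAbs_det_basis_change e N (Module.Basis.mk hli hsp)
  have hdet : e.det ((↑) ∘ Module.Basis.mk hli hsp) = f.eval x y := by
    have hrepr : ∀ s t : ℤ, e.repr (s • e 0 + t • e 1) 0 = s ∧
        e.repr (s • e 0 + t • e 1) 1 = t := by
      intro s t
      rw [map_add, map_smul, map_smul, e.repr_self, e.repr_self]
      simp
    rw [Module.Basis.det_apply, Matrix.det_fin_two]
    simp only [Module.Basis.toMatrix_apply, Function.comp_apply, Module.Basis.mk_apply,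
      Matrix.cons_val_zero, Matrix.cons_val_one]
    change e.repr p 0 * e.repr q 1 - e.repr q 0 * e.repr p 1 = _
    rw [(hrepr _ _).1, (hrepr _ _).2, (hrepr _ _).1, (hrepr _ _).2, BinForm.eval]
    ring
  rw [hdet] at key
  exact key.symm

/-! ### Congruences modulo N𝒪 -/

/-- Every element of `𝒫₀(𝒪, N)` is a quotient `α𝒪 / β𝒪` of two generators. -/
theorem exists_of_mem_principalGroup {D : ℤ} {N : ℕ} {u : (FracIdeal D)ˣ}
    (hu : u ∈ principalGroup D N) :
    ∃ (α β : quadOrder D) (k l : ℤ), IsCoprime k (N : ℤ) ∧ IsCoprime l (N : ℤ) ∧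
      α - (k : quadOrder D) ∈ Ideal.span {(N : quadOrder D)} ∧
      β - (l : quadOrder D) ∈ Ideal.span {(N : quadOrder D)} ∧ α ≠ 0 ∧ β ≠ 0 ∧
      ((Ideal.span {β} : Ideal (quadOrder D)) : FracIdeal D) * u =
        ((Ideal.span {α} : Ideal (quadOrder D)) : FracIdeal D) := by
  have hcong : ∀ {α β : quadOrder D} {k l : ℤ},
      α - (k : quadOrder D) ∈ Ideal.span {(N : quadOrder D)} →
      β - (l : quadOrder D) ∈ Ideal.span {(N : quadOrder D)} →
      α * β - ((k * l : ℤ) : quadOrder D) ∈ Ideal.span {(N : quadOrder D)} := by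
    intro α β k l hα hβ
    have h : α * β - ((k * l : ℤ) : quadOrder D) = β * (α - k) + k * (β - l) := by
      push_cast; ring
    rw [h]
    exact add_mem (Ideal.mul_mem_left _ _ hα) (Ideal.mul_mem_left _ _ hβ)
  induction hu using Subgroup.closure_induction with
  | mem u hu =>
    obtain ⟨α, k, hk, hα, h⟩ := hu
    refine ⟨α, 1, k, 1, hk, isCoprime_one_left, hα, by simp, ?_, one_ne_zero, by simp [h]⟩
    -- Generators of 𝒫₀ come as units, so α = 0 is impossible: the zero ideal is not invertible.
    rintro rfl
    exact u.ne_zero (by simp [h])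
  | one =>
    exact ⟨1, 1, 1, 1, isCoprime_one_left, isCoprime_one_left, by simp, by simp, one_ne_zero,
      one_ne_zero, by simp⟩
  | mul u v _ _ hu hv =>
    obtain ⟨α, β, k, l, hk, hl, hα, hβ, hα0, hβ0, h⟩ := hu
    obtain ⟨α', β', k', l', hk', hl', hα', hβ', hα0', hβ0', h'⟩ := hv
    refine ⟨α * α', β * β', k * k', l * l', hk.mul_left hk', hl.mul_left hl', hcong hα hα',
      hcong hβ hβ', mul_ne_zero hα0 hα0', mul_ne_zero hβ0 hβ0', ?_⟩
    rw [← Ideal.span_singleton_mul_span_singleton, ← Ideal.span_singleton_mul_span_singleton,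
      FractionalIdeal.coeIdeal_mul, FractionalIdeal.coeIdeal_mul, ← h, ← h', Units.val_mul]
    ring
  | inv u _ hu =>
    obtain ⟨α, β, k, l, hk, hl, hα, hβ, hα0, hβ0, h⟩ := hu
    exact ⟨β, α, l, k, hl, hk, hβ, hα, hβ0, hα0, by rw [← h, Units.mul_inv_cancel_right]⟩

/-- If `β = a (x - y τ̄_f)` satisfies `l β ≡ k (mod N𝒪)` with `k` and `l` prime to `N`, then
`x` is prime to `N` and `N ∣ y`. -/
theorem isCoprime_and_dvd_of_conjElement {D : ℤ} {N : ℕ} {f : BinForm} (hf : f ∈ QF D)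
    {x y k l : ℤ} (hk : IsCoprime k (N : ℤ))
    (hl : IsCoprime l (N : ℤ))
    (h : (l : quadOrder D) * conjElement hf x y - k ∈ Ideal.span {(N : quadOrder D)}) :
    IsCoprime x (N : ℤ) ∧ (N : ℤ) ∣ y := by
  obtain ⟨⟨r, hr⟩, h⟩ := Ideal.mem_span_singleton'.mp h
  obtain ⟨u, v, rfl⟩ := (mem_quadOrder hf).mp hr
  have h' := congrArg (Subtype.val : quadOrder D → QuadField D) h
  push_cast at h'
  rw [coe_conjElement] at h'
  -- Coordinates of lλ - k = N(u + v·aτ_f). Independence concerns 1 and τ_f, so the second relation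
  -- carries a factor a, cancelled next.
  obtain ⟨h1, h2⟩ := int_add_mul_tau_eq_zero hf
    (u := l * (f.a * x + f.b * y) - k - N * u) (v := (l * y - N * v) * f.a)
    (by push_cast; linear_combination -h')
  have h3 := (mul_eq_zero.mp h2).resolve_right (QF.a_pos hf).ne'
  have hy : (N : ℤ) ∣ y := hl.symm.dvd_of_dvd_mul_left ⟨v, by linear_combination h3⟩
  refine ⟨?_, hy⟩
  obtain ⟨w, rfl⟩ := hy
  obtain ⟨s, t, hst⟩ := hk
  -- Substitute k = l(ax + bNw) - Nu into the Bézout relation sk + tN = 1.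
  exact ⟨s * l * f.a, t - s * u + s * l * f.b * w, by linear_combination hst + s * h1⟩

/-! ### Integral ideals in the class of ℤ + ℤτ_f -/

/-- The lattice `a (x - y τ̄_f) (ℤ + ℤ τ_f)` is an integral ideal. -/
theorem exists_ideal_eq_conjElement_mul {D : ℤ} {f : BinForm} (hf : f ∈ QF D) (x y : ℤ) :
    ∃ 𝔞 : Ideal (quadOrder D), (𝔞 : FracIdeal D) =
      ((Ideal.span {conjElement hf x y} : Ideal (quadOrder D)) : FracIdeal D) *
        latticeIdeal hf := by
  refine FractionalIdeal.le_one_iff_exists_coeIdeal.mp ?_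
  intro z hz
  obtain ⟨_, ⟨u, v, rfl⟩, rfl⟩ := (mem_span_mul _ _).mp hz
  have hmem : (conjElement hf x y : QuadField D) * (u + v * tau D f) ∈ quadOrder D := by
    refine (mem_quadOrder hf).mpr ⟨u * (f.a * x + f.b * y) - v * (f.c * y), u * y + v * x, ?_⟩
    rw [mul_add, mul_left_comm, conjElement_mul_tau, coe_conjElement]
    push_cast
    ring
  exact (FractionalIdeal.mem_one_iff _).mpr ⟨⟨_, hmem⟩, rfl⟩

/-- A nonzero element of `𝒪` generates an invertible fractional ideal. -/
theorem isUnit_coe_span_singleton {D : ℤ} {α : quadOrder D} (hα : α ≠ 0) :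
    IsUnit ((Ideal.span {α} : Ideal (quadOrder D)) : FracIdeal D) := by
  have h : (α : QuadField D) ≠ 0 := fun h => hα (Subtype.ext h)
  -- The inverse is α⁻¹𝒪, with α itself as common denominator.
  let J : FracIdeal D := ⟨Submodule.span (quadOrder D) {(α : QuadField D)⁻¹}, α,
    mem_nonZeroDivisors_of_ne_zero hα, by
      intro z hz
      obtain ⟨r, rfl⟩ := Submodule.mem_span_singleton.mp hz
      refine ⟨r, ?_⟩
      rw [Subalgebra.smul_def, Subalgebra.smul_def, smul_eq_mul, smul_eq_mul, mul_left_comm,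
        mul_inv_cancel₀ h, mul_one]
      rfl⟩
  have hJ : ∀ z : QuadField D, z ∈ J ↔ ∃ r : quadOrder D, r • (α : QuadField D)⁻¹ = z :=
    fun _ => Submodule.mem_span_singleton
  refine IsUnit.of_mul_eq_one J (FractionalIdeal.ext fun z => ?_)
  rw [mem_span_mul, FractionalIdeal.mem_one_iff]
  constructor
  · rintro ⟨x, hx, rfl⟩
    obtain ⟨r, rfl⟩ := (hJ x).mp hx
    refine ⟨r, ?_⟩
    rw [Subalgebra.smul_def, smul_eq_mul, mul_left_comm, mul_inv_cancel₀ h, mul_one]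
    rfl
  · rintro ⟨r, rfl⟩
    refine ⟨_, (hJ _).mpr ⟨r, rfl⟩, ?_⟩
    rw [Subalgebra.smul_def, smul_eq_mul, mul_left_comm, mul_inv_cancel₀ h, mul_one]
    rfl

/-- The lattices `a (x - y τ̄_f) (ℤ + ℤ τ_f)` with `x` prime to `N` and `N ∣ y` are
exactly the integral ideals in the class `Φ([f])`. -/
theorem inClass_Phi_iff {D : ℤ} {N : ℕ} {f : BinForm} (hf : f ∈ QF D)
    (hfN : IsCoprime f.a (N : ℤ)) (𝔞 : Ideal (quadOrder D)) :
    InClass 𝔞 (Phi D N (formClass f hf hfN)) ↔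
      ∃ x y : ℤ, IsCoprime x (N : ℤ) ∧ (N : ℤ) ∣ y ∧ f.eval x y ≠ 0 ∧
        (𝔞 : FracIdeal D) =
          ((Ideal.span {conjElement hf x y} : Ideal (quadOrder D)) : FracIdeal D) *
            latticeIdeal hf := by
  constructor
  · rintro ⟨u, hu, hC⟩
    have hP := Subgroup.mem_subgroupOf.mp (QuotientGroup.eq.mp hC.symm)
    obtain ⟨α, β, k, l, hk, hl, hα, hβ, hα0, hβ0, h⟩ := exists_of_mem_principalGroup hP
    -- Since L⁻¹𝔞 lies in 𝒫₀, it is α𝒪/β𝒪; clearing inverses gives β𝔞 = αL.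
    have hmul : ((Ideal.span {β} : Ideal (quadOrder D)) : FracIdeal D) * 𝔞 =
        ((Ideal.span {α} : Ideal (quadOrder D)) : FracIdeal D) * latticeIdeal hf := by
      rw [← hu, ← h]
      change _ = _ * (((isUnit_latticeIdeal hf).unit⁻¹ * (u : (FracIdeal D)ˣ) :
        (FracIdeal D)ˣ) : FracIdeal D) * (isUnit_latticeIdeal hf).unit
      rw [mul_assoc, ← Units.val_mul, mul_right_comm, inv_mul_cancel, one_mul]
    have hβK : (β : QuadField D) ≠ 0 := fun h => hβ0 (Subtype.ext h)
    -- (α/β)L = 𝔞 is integral; taking w = 1 and w = τ_f identifies α/β as some λ.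
    have hint : ∀ w ∈ latticeIdeal hf, (α / β : QuadField D) * w ∈ quadOrder D := by
      intro w hw
      have h1 : (α : QuadField D) * w ∈
          ((Ideal.span {β} : Ideal (quadOrder D)) : FracIdeal D) * 𝔞 := by
        rw [hmul]
        exact (mem_span_mul _ _).mpr ⟨w, hw, rfl⟩
      obtain ⟨z, hz, h2⟩ := (mem_span_mul _ _).mp h1
      obtain ⟨t, -, rfl⟩ := (FractionalIdeal.mem_coeIdeal _).mp hz
      rw [div_mul_eq_mul_div, h2, mul_div_cancel_left₀ _ hβK]
      exact t.2
    obtain ⟨x, y, hxy⟩ := exists_eq_conjElement hf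
      (by simpa using hint 1 ⟨1, 0, by simp⟩) (hint (tau D f) ⟨0, 1, by simp⟩)
    have hαβ : α = β * conjElement hf x y := by
      apply Subtype.ext
      change (α : QuadField D) = β * conjElement hf x y
      rw [← hxy, mul_div_cancel₀ _ hβK]
    obtain ⟨hx, hy⟩ := isCoprime_and_dvd_of_conjElement hf (x := x) (y := y) hk hl (by
      have h3 : (l : quadOrder D) * conjElement hf x y - k =
          (α - k) - conjElement hf x y * (β - l) := by
        rw [hαβ]; ring
      rw [h3]
      exact sub_mem hα (Ideal.mul_mem_left _ _ hβ))
    refine ⟨x, y, hx, hy, fun h0 => ?_, ?_⟩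
    · have hxy0 : x = 0 ∧ y = 0 := by
        by_contra hne
        exact (hf.2.1 x y (not_and_or.mp hne)).ne' h0
      obtain ⟨rfl, rfl⟩ := hxy0
      refine hα0 (hαβ.trans ?_)
      have : conjElement hf 0 0 = 0 := Subtype.ext (by simp [coe_conjElement])
      rw [this, mul_zero]
    · rw [hαβ, ← Ideal.span_singleton_mul_span_singleton, FractionalIdeal.coeIdeal_mul,
        mul_assoc] at hmul
      exact (isUnit_coe_span_singleton hβ0).mul_left_cancel hmul
  · rintro ⟨x, y, hx, ⟨w, rfl⟩, h0, h⟩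
    have hne : conjElement hf x (N * w) ≠ 0 := fun h =>
      conjElement_ne_zero hf h0 (congrArg Subtype.val h)
    have hB := isUnit_coe_span_singleton hne
    -- With y = Nw, λ - ax = N(wb + w·aτ_f).
    have hcong : conjElement hf x (N * w) - ((f.a * x : ℤ) : quadOrder D) ∈
        Ideal.span {(N : quadOrder D)} := by
      refine Ideal.mem_span_singleton'.mpr ⟨⟨w * f.b + w * (f.a * tau D f),
        (mem_quadOrder hf).mpr ⟨w * f.b, w, by push_cast; ring⟩⟩, Subtype.ext ?_⟩
      push_cast
      rw [coe_conjElement]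
      push_cast
      ring
    have hcop : IsCoprime (f.a * x) (N : ℤ) := hfN.mul_left hx
    have hBP : hB.unit ∈ principalGroup D N := Subgroup.subset_closure ⟨_, _, hcop, hcong, rfl⟩
    have hBI : hB.unit ∈ idealGroup D N := by
      refine Subgroup.subset_closure ⟨_, hB.isProper, ?_, rfl⟩
      rw [Ideal.eq_top_iff_one]
      obtain ⟨s, t, hst⟩ := hcop
      -- λ is congruent modulo N to an integer prime to N, so λ𝒪 + N𝒪 = 𝒪; this turns s(ax) + tN = 1
      -- into a relation for λ.
      have h1 : (1 : quadOrder D) = s * conjElement hf x (N * w) +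
          (t * N - s * (conjElement hf x (N * w) - ((f.a * x : ℤ) : quadOrder D))) := by
        have : (s : quadOrder D) * ((f.a * x : ℤ) : quadOrder D) + t * N = 1 := by
          exact_mod_cast hst
        linear_combination -this
      rw [h1]
      exact Submodule.add_mem_sup
        (Ideal.mul_mem_left _ _ (Ideal.mem_span_singleton_self _))
        (sub_mem (Ideal.mul_mem_left _ _ (Ideal.mem_span_singleton_self _))
          (Ideal.mul_mem_left _ _ hcong))
    refine ⟨⟨hB.unit, hBI⟩ * latticeUnit ⟨f, hf, hfN⟩, h.symm, Eq.symm ?_⟩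
    refine QuotientGroup.eq.mpr (Subgroup.mem_subgroupOf.mpr ?_)
    rw [mul_comm (⟨hB.unit, hBI⟩ : idealGroup D N), inv_mul_cancel_left]
    exact hBP

/-! ### The N-represented integers as norms -/

theorem mainTheorem6 (D : ℤ) (hD : D < 0) (N : ℕ) (hN : 0 < N) (f : BinForm) (hf : f ∈ QF D)
    (hfN : IsCoprime f.a (N : ℤ)) (m : ℕ) (hm : 0 < m) :
    f.NRepresents N (m : ℤ) ↔
      ∃ 𝔞 : Ideal (quadOrder D), IsProper (𝔞 : FracIdeal D) ∧
        InClass 𝔞 (Phi D N (formClass f hf hfN)) ∧ m = Nat.card (quadOrder D ⧸ 𝔞) := by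
  constructor
  · rintro ⟨x, y, hx, hy, hxy⟩
    have h0 : f.eval x y ≠ 0 := by omega
    obtain ⟨𝔞, h𝔞⟩ := exists_ideal_eq_conjElement_mul hf x y
    have hne : conjElement hf x y ≠ 0 := fun h =>
      conjElement_ne_zero hf h0 (congrArg Subtype.val h)
    refine ⟨𝔞, ?_, (inClass_Phi_iff hf hfN 𝔞).mpr ⟨x, y, hx, hy, h0, h𝔞⟩, ?_⟩
    · rw [h𝔞]
      -- λ𝒪 and L are both invertible, hence so is λL, and invertible ideals are proper.
      exact ((isUnit_coe_span_singleton hne).mul (isUnit_latticeIdeal hf)).isProper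
    · rw [natCard_quotient_eq_eval hf h0 𝔞 h𝔞, ← hxy, Int.natAbs_natCast]
  · rintro ⟨𝔞, -, h𝔞, rfl⟩
    obtain ⟨x, y, hx, hy, h0, h⟩ := (inClass_Phi_iff hf hfN 𝔞).mp h𝔞
    refine ⟨x, y, hx, hy, ?_⟩
    rw [natCard_quotient_eq_eval hf h0 𝔞 h]
    -- The norm is only known as |f(x, y)|; positive definiteness removes the absolute value.
    have hpos : 0 < f.eval x y := by
      refine hf.2.1 x y (not_and_or.mp ?_)
      rintro ⟨rfl, rfl⟩
      exact h0 (by simp [BinForm.eval])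
    exact Int.natAbs_of_nonneg hpos.le
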